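/- Let $Q=(q_{ij})_{i,j\ge 0}$ be a real matrix such that, for every $i\ge 0$, $q_{i,i+1}>0$, $q_{ij}=0$ for $j>i+1$, and $\sum_{j=0}^{i+1}q_{ij}=0$. Let $(X_t)_{t\ge 0}$ be a right-continuous Markov process on $\{0,1,2,\dots\}$ with generator $Q$, started at $0$: there is a transition function $(P_t)_{t\ge0}$ (a semigroup of nonnegative matrices with row sums at most one, $P_0=I$) with entrywise right derivative $Q$ at $t=0$ such that, given the past of $X$ up to time $s$ and $X_s=i$, the probability that $X_{s+t}=j$ is $P_t(i,j)$. (The process may explode; at times when it is not in $\{0,1,2,\dots\}$ it takes an extra value $\infty$, the point at infinity of the one-point compactification.) For $n\ge 0$ let $Q_n=(q_{ij})_{0\le i,j\le n-1}$ be the upper left $n\times n$ block of $Q$, let $T_n=\inf\{t\ge 0: X_t=n\}$, and for $0\le i\le n-1$ let $l^i_{T_n}=\int_0^{T_n}\mathbf 1_{\{X_s=i\}}\,ds$ be the time spent in state $i$ before reaching $n$. Then $T_n<\infty$ and all $l^i_{T_n}<\infty$ almost surely, and for all $d_0,\dots,d_{n-1}\ge 0$, with $D=\operatorname{diag}(d_0,\dots,d_{n-1})$,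 the variable $e^{-\sum_i d_i l^i_{T_n}}$ is integrable, $\det(D-Q_n)\neq 0$, and $$\mathbf E_0\Big[e^{-\sum_{i=0}^{n-1} d_i\, l^i_{T_n}}\Big]=\frac{\det(-Q_n)}{\det(D-Q_n)}.$$ -/

import Mathlib

open MeasureTheory Filter Topology
open scoped NNReal ENNReal

namespace SkipFree

/-- The matrix condition: `q i (i+1) > 0`, `q i j = 0` for `j > i + 1`, and the `i`-th row, whose
entries vanish beyond column `i + 1`, sums to zero. -/
structure IsSkipFree (Q : Matrix ℕ ℕ ℝ) : Prop where
  up_pos : ∀ i, 0 < Q i (i + 1)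
  eq_zero : ∀ i j, i + 1 < j → Q i j = 0
  row_sum : ∀ i, ∑ j ∈ Finset.range (i + 2), Q i j = 0

/-- `P` is a transition function on `ℕ` with generator (`Q`-matrix) `Q`: a semigroup of
nonnegative matrices with row sums at most one (less than one if mass is lost by explosion)
and `P 0 = 1`, whose entrywise right derivative at time zero is `Q`. -/
structure IsTransitionFunction (P : ℝ≥0 → Matrix ℕ ℕ ℝ) (Q : Matrix ℕ ℕ ℝ) : Prop where
  nonneg : ∀ t i j, 0 ≤ P t i j
  summable : ∀ t i, Summable (P t i)
  row_sum_le : ∀ t i, ∑' j, P t i j ≤ 1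
  zero : P 0 = 1
  semigroup : ∀ s t i j, P (s + t) i j = ∑' k, P s i k * P t k j
  generator : ∀ i j, Tendsto (fun t : ℝ≥0 => (P t i j - P 0 i j) / (t : ℝ)) (𝓝[>] 0)
    (𝓝 (Q i j))

/-- The `σ`-algebra generated by the process `X` up to time `s`. -/
@[reducible]
def past {Ω : Type*} (X : ℝ≥0 → Ω → ℕ∞) (s : ℝ≥0) : MeasurableSpace Ω :=
  ⨆ r : Set.Iic s, MeasurableSpace.comap (X r) inferInstance

/-- `X` is, under `μ`, a continuous-time Markov process on `ℕ` with generator `Q`, started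
at `x`. The paths are right-continuous, and given the past up to time `s` and `X s = i`, the
probability of `X (s + t) = j` is `P t i j`, for a transition function `P` with generator `Q`.
The extra value `⊤` (the point at infinity of the compactification `ℕ∞` of `ℕ`) is only there for
processes that explode; a process which never explodes does not take it. -/
structure IsMarkovProcess {Ω : Type*} [MeasurableSpace Ω] (μ : Measure Ω)
    (X : ℝ≥0 → Ω → ℕ∞) (Q : Matrix ℕ ℕ ℝ) (x : ℕ) : Prop where
  measurable : ∀ t, Measurable (X t)
  start : ∀ᵐ ω ∂μ, X 0 ω = x
  rightContinuous : ∀ᵐ ω ∂μ, ∀ t, ContinuousWithinAt (fun s => X s ω) (Set.Ici t) t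
  markov : ∃ P : ℝ≥0 → Matrix ℕ ℕ ℝ, IsTransitionFunction P Q ∧
    ∀ (s t : ℝ≥0) (i j : ℕ) (A : Set Ω), MeasurableSet[past X s] A →
      μ (A ∩ {ω | X s ω = i} ∩ {ω | X (s + t) ω = j}) =
        μ (A ∩ {ω | X s ω = i}) * ENNReal.ofReal (P t i j)

/-- The first time (possibly infinite) at which `X` is in the state `n`. -/
noncomputable def hittingTime {Ω : Type*} (X : ℝ≥0 → Ω → ℕ∞) (n : ℕ) (ω : Ω) : ℝ≥0∞ :=
  ⨅ (t : ℝ≥0) (_ : X t ω = n), (t : ℝ≥0∞)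

/-- The amount of time spent by `X` in the state `i` before time `T`. -/
noncomputable def occupationTime {Ω : Type*} (X : ℝ≥0 → Ω → ℕ∞) (i : ℕ) (T : ℝ≥0∞) (ω : Ω) :
    ℝ≥0∞ :=
  ∫⁻ s in {s : ℝ | 0 ≤ s ∧ ENNReal.ofReal s < T}, Set.indicator {s | X s.toNNReal ω = i} 1 s

/-- The upper left `n × n` block of `Q`. -/
def upperBlock (Q : Matrix ℕ ℕ ℝ) (n : ℕ) : Matrix (Fin n) (Fin n) ℝ :=
  Q.submatrix (fun i => (i : ℕ)) (fun j => (j : ℕ))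

end SkipFree

/-! Discretizing time reduces everything to the matrices P_h and the Markov property at
deterministic times; no jump chain or stopping time is needed. Observe X at the multiples of h, with
a factor e^{-d_j h} for each visit to j < n. With A_h the `killedMatrix` and b_h the `exitVector`,
the expected weight of the grid paths that leave {0, …, n-1} into n is e^{-d_0 h} v_h(0), where v_h
= ∑ A_h^m b_h solves (1 - A_h) v_h = b_h (`exists_hasSum_pow_mulVec`, `lintegral_gridFunctional`).
As h → 0, (1 - A_h)/h → D - Q_n and b_h/h → r = (q_{in})_i, so Cramer's rule gives det(D - Q_n) ·
lim v_h(0) = (adj(D - Q_n) r)_0. By skip-freeness this is ∏ q_{i,i+1}, whatever D is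
(`adjugate_mulVec_exitRate`); D = 0 identifies it as det(-Q_n).

On the path side, right-continuity makes the grid weight converge to e^{-∑ d_i l^i} if the path
first leaves {0, …, n-1} into n, and to 0 otherwise (`tendsto_gridFunctional_exitFunctional`).
Dominated convergence yields det(D - Q_n) E[e^{-∑ d_i l^i}; exit into n] = det(-Q_n). Since
det(-Q_n) > 0, the case D = 0 says that the exit into n has probability one: jumping over n,
exploding first and staying below n forever are excluded at once. Positivity also forces det(D -
Q_n) ≠ 0. -/

namespace SkipFree

/-! ### Linear algebra of the killed chain and of skip-free matrices -/

/-- The one-step matrix of the chain observed at the multiples of `h`, killed on leaving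
`{0, …, n - 1}` and at rate `d`. -/
noncomputable def killedMatrix {n : ℕ} (P : ℝ≥0 → Matrix ℕ ℕ ℝ) (d : Fin n → ℝ) (h : ℝ≥0) :
    Matrix (Fin n) (Fin n) ℝ :=
  Matrix.of fun i j => P h i j * Real.exp (-(d j * h))

/-- The one-step probabilities of moving to `n`. -/
def exitVector (n : ℕ) (P : ℝ≥0 → Matrix ℕ ℕ ℝ) (h : ℝ≥0) : Fin n → ℝ := fun i => P h i n

/-- The rates of the transitions to `n`. -/
def exitRate (n : ℕ) (Q : Matrix ℕ ℕ ℝ) : Fin n → ℝ := fun i => Q i n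

/-- Splitting off the first step bounds all partial sums by 1, by induction, so the series converges
without `1 - A` being known to be invertible. -/
theorem exists_hasSum_pow_mulVec {n : ℕ} (A : Matrix (Fin n) (Fin n) ℝ) (b : Fin n → ℝ)
    (hA : ∀ i j, 0 ≤ A i j) (hb : ∀ i, 0 ≤ b i) (h1 : ∀ i, b i + ∑ j, A i j ≤ 1) :
    ∃ v : Fin n → ℝ, (∀ i, HasSum (fun m : ℕ => ((A ^ m).mulVec b) i) (v i)) ∧
      (1 - A).mulVec v = b := by
  have hsucc : ∀ m i, ((A ^ (m + 1)).mulVec b) i = ∑ j, A i j * ((A ^ m).mulVec b) j := by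
    intro m i
    rw [pow_succ', ← Matrix.mulVec_mulVec]
    rfl
  have hnn : ∀ m i, 0 ≤ ((A ^ m).mulVec b) i := by
    intro m
    induction m with
    | zero => simpa using hb
    | succ m ih =>
      intro i
      rw [hsucc]
      exact Finset.sum_nonneg fun j _ => mul_nonneg (hA i j) (ih j)
  have hle : ∀ M i, ∑ m ∈ Finset.range M, ((A ^ m).mulVec b) i ≤ 1 := by
    intro M
    induction M with
    | zero => intro i; simp
    | succ M ih =>
      intro i
      rw [Finset.sum_range_succ']
      simp only [hsucc, pow_zero, Matrix.one_mulVec]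
      rw [Finset.sum_comm]
      simp only [← Finset.mul_sum]
      have : ∑ j, A i j * ∑ m ∈ Finset.range M, ((A ^ m).mulVec b) j ≤ ∑ j, A i j :=
        Finset.sum_le_sum fun j _ => mul_le_of_le_one_right (hA i j) (ih j)
      linarith [h1 i]
  have hs : ∀ i, Summable fun m : ℕ => ((A ^ m).mulVec b) i := fun i =>
    summable_of_sum_range_le (fun m => hnn m i) (fun M => hle M i)
  refine ⟨fun i => ∑' m, ((A ^ m).mulVec b) i, fun i => (hs i).hasSum, ?_⟩
  ext i
  rw [Matrix.sub_mulVec, Matrix.one_mulVec, Pi.sub_apply, (hs i).tsum_eq_zero_add]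
  simp only [hsucc, pow_zero, Matrix.one_mulVec]
  rw [Summable.tsum_finsetSum fun j _ => (hs j).mul_left (A i j)]
  simp only [tsum_mul_left, Matrix.mulVec, dotProduct]
  ring

/-- Only the last state has a positive exit rate, so a single cofactor contributes. Deleting the
last row and column 0 leaves a lower triangular matrix with diagonal -q_{i,i+1}; the surviving
entries of `d` lie strictly below it, which is why they disappear. The two signs (-1)^N cancel. -/
theorem adjugate_mulVec_exitRate {N : ℕ} {Q : Matrix ℕ ℕ ℝ} (hQ : IsSkipFree Q)
    (d : Fin (N + 1) → ℝ) :
    ((Matrix.diagonal d - upperBlock Q (N + 1)).adjugate.mulVec (exitRate (N + 1) Q)) 0 =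
      ∏ i ∈ Finset.range (N + 1), Q i (i + 1) := by
  have h0 : ∀ i : Fin N, exitRate (N + 1) Q i.castSucc = 0 := fun i =>
    hQ.eq_zero _ _ (by simp)
  have hdet : ((Matrix.diagonal d - upperBlock Q (N + 1)).submatrix
      (Fin.last N).succAbove (Fin.succAbove 0)).det = ∏ i : Fin N, -Q i (i + 1) := by
    rw [Matrix.det_of_isLowerTriangular]
    · refine Finset.prod_congr rfl fun i _ => ?_
      simp [upperBlock, Fin.ext_iff]
    · intro i j hij
      have hij : i < j := hij
      have h1 : (i.castSucc : Fin (N + 1)) ≠ j.succ := by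
        simp only [ne_eq, Fin.ext_iff, Fin.val_castSucc, Fin.val_succ]
        omega
      simp only [Matrix.submatrix_apply, Fin.succAbove_last, Fin.zero_succAbove,
        Matrix.sub_apply, Matrix.diagonal_apply_ne _ h1, upperBlock]
      rw [hQ.eq_zero]
      · simp
      · simpa using hij
  simp only [Matrix.mulVec, dotProduct]
  rw [Fin.sum_univ_castSucc]
  simp only [h0, mul_zero, Finset.sum_const_zero, zero_add]
  rw [Matrix.adjugate_fin_succ_eq_det_submatrix, hdet, Finset.prod_neg, Finset.prod_range_succ,
    Finset.prod_range]
  simp only [Finset.card_univ, Fintype.card_fin, exitRate, Fin.val_last, Fin.val_zero, add_zero]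
  rw [← mul_assoc, ← pow_add, Even.neg_one_pow ⟨N, rfl⟩, one_mul]

theorem neg_upperBlock_mulVec_one {n : ℕ} {Q : Matrix ℕ ℕ ℝ} (hQ : IsSkipFree Q) :
    (-upperBlock Q n).mulVec 1 = exitRate n Q := by
  ext i
  have h1 : ∑ j ∈ Finset.range (n + 1), Q i j = 0 := by
    rw [← hQ.row_sum i]
    symm
    refine Finset.sum_subset (Finset.range_subset_range.2 (by omega)) fun j _ hj => ?_
    rw [Finset.mem_range] at hj
    exact hQ.eq_zero _ _ (by omega)
  rw [Finset.sum_range_succ, Finset.sum_range] at h1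
  simp only [Matrix.mulVec, dotProduct, upperBlock, exitRate, Matrix.neg_apply,
    Matrix.submatrix_apply, Pi.one_apply, mul_one, Finset.sum_neg_distrib]
  linarith

/-- The exit rates are -Q_n applied to the constant vector 1, so the adjugate of -Q_n sends them to
det(-Q_n) times that vector. -/
theorem det_neg_upperBlock {N : ℕ} {Q : Matrix ℕ ℕ ℝ} (hQ : IsSkipFree Q) :
    (-upperBlock Q (N + 1)).det = ∏ i ∈ Finset.range (N + 1), Q i (i + 1) := by
  rw [← adjugate_mulVec_exitRate hQ 0]
  rw [Matrix.diagonal_zero', zero_sub, ← neg_upperBlock_mulVec_one hQ, Matrix.mulVec_mulVec,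
    Matrix.adjugate_mul, Matrix.smul_mulVec, Matrix.one_mulVec]
  simp

theorem det_neg_upperBlock_pos {N : ℕ} {Q : Matrix ℕ ℕ ℝ} (hQ : IsSkipFree Q) :
    0 < (-upperBlock Q (N + 1)).det := by
  rw [det_neg_upperBlock hQ]
  exact Finset.prod_pos fun i _ => hQ.up_pos i

/-! ### Limits of the discretized matrices as the mesh tends to zero -/

section mesh

variable {n : ℕ} {P : ℝ≥0 → Matrix ℕ ℕ ℝ} {Q : Matrix ℕ ℕ ℝ}

theorem tendsto_coe_nhdsGT_zero :
    Tendsto (fun h : ℝ≥0 => (h : ℝ)) (𝓝[>] 0) (𝓝 0) :=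
  (NNReal.continuous_coe.tendsto' 0 0 rfl).mono_left nhdsWithin_le_nhds

theorem tendsto_exp_neg_mul (c : ℝ) :
    Tendsto (fun h : ℝ≥0 => Real.exp (-(c * h))) (𝓝[>] 0) (𝓝 1) := by
  simpa [Function.comp_def] using
    (Real.continuous_exp.tendsto _).comp (tendsto_coe_nhdsGT_zero.const_mul c).neg

theorem tendsto_one_sub_exp_div (c : ℝ) :
    Tendsto (fun h : ℝ≥0 => (1 - Real.exp (-(c * h))) / h) (𝓝[>] 0) (𝓝 c) := by
  have h1 : HasDerivAt (fun t : ℝ => Real.exp (-(c * t))) (-c) 0 := by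
    have := ((hasDerivAt_id (0 : ℝ)).const_mul c).neg.exp
    simpa using this
  have h2 := (hasDerivAt_iff_tendsto_slope.1 h1).comp
    (show Tendsto (fun h : ℝ≥0 => (h : ℝ)) (𝓝[>] 0) (𝓝[≠] 0) from
      tendsto_nhdsWithin_iff.2 ⟨tendsto_coe_nhdsGT_zero,
        eventually_nhdsWithin_of_forall fun h (hh : 0 < h) => by simpa using hh.ne'⟩)
  refine (neg_neg c ▸ h2.neg).congr fun h => ?_
  simp [slope, div_eq_inv_mul]
  ring

theorem tendsto_killedMatrix (hP : IsTransitionFunction P Q) (d : Fin n → ℝ) :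
    Tendsto (fun h : ℝ≥0 => (h : ℝ)⁻¹ • (1 - killedMatrix P d h)) (𝓝[>] 0)
      (𝓝 (Matrix.diagonal d - upperBlock Q n)) := by
  refine tendsto_pi_nhds.2 fun i => tendsto_pi_nhds.2 fun j => ?_
  -- With e = e^{-d_j h}, split δ_{ij} - P_h(i,j) e = δ_{ij} (1 - e) - (P_h(i,j) - δ_{ij}) e.
  have h1 := (hP.generator i j).mul (tendsto_exp_neg_mul (d j))
  have h2 := (tendsto_one_sub_exp_div (d j)).const_mul ((1 : Matrix (Fin n) (Fin n) ℝ) i j)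
  have h3 := h2.sub h1
  have h4 : (Matrix.diagonal d - upperBlock Q n) i j =
      (1 : Matrix (Fin n) (Fin n) ℝ) i j * d j - Q i j * 1 := by
    rcases eq_or_ne i j with rfl | hij
    · simp [upperBlock]
    · simp [upperBlock, hij]
  rw [h4]
  refine h3.congr fun h => ?_
  have h5 : P 0 i j = (1 : Matrix (Fin n) (Fin n) ℝ) i j := by
    rw [hP.zero]
    simp [Matrix.one_apply, Fin.ext_iff]
  simp only [h5, Matrix.smul_apply, Matrix.sub_apply, killedMatrix, Matrix.of_apply, smul_eq_mul]
  ring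

theorem tendsto_exitVector (hP : IsTransitionFunction P Q) :
    Tendsto (fun h : ℝ≥0 => (h : ℝ)⁻¹ • exitVector n P h) (𝓝[>] 0) (𝓝 (exitRate n Q)) := by
  refine tendsto_pi_nhds.2 fun i => (hP.generator i n).congr fun h => ?_
  have h5 : P 0 i n = 0 := by
    rw [hP.zero, Matrix.one_apply_ne i.2.ne]
  simp [h5, exitVector, div_eq_inv_mul]

theorem killedMatrix_nonneg (hP : IsTransitionFunction P Q) (d : Fin n → ℝ) (h : ℝ≥0) (i j) :
    0 ≤ killedMatrix P d h i j :=
  mul_nonneg (hP.nonneg _ _ _) (Real.exp_pos _).le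

theorem exitVector_add_sum_killedMatrix_le (hP : IsTransitionFunction P Q) {d : Fin n → ℝ}
    (hd : ∀ i, 0 ≤ d i) (h : ℝ≥0) (i : Fin n) :
    exitVector n P h i + ∑ j, killedMatrix P d h i j ≤ 1 := by
  have h1 : ∑ j ∈ Finset.range (n + 1), P h i j ≤ 1 :=
    ((hP.summable h i).sum_le_tsum _ fun j _ => hP.nonneg h i j).trans (hP.row_sum_le h i)
  rw [Finset.sum_range_succ, Finset.sum_range] at h1
  have h2 : ∑ j, killedMatrix P d h i j ≤ ∑ j : Fin n, P h i j :=
    Finset.sum_le_sum fun j _ => mul_le_of_le_one_right (hP.nonneg _ _ _)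
      (Real.exp_le_one_iff.2 (neg_nonpos.2 (mul_nonneg (hd j) h.2)))
  simp only [exitVector]
  linarith

/-- The limit, as the mesh tends to zero, of the solutions of the discretized equations. -/
theorem det_mul_eq_of_tendsto {N : ℕ} (hQ : IsSkipFree Q) (hP : IsTransitionFunction P Q)
    (d : Fin (N + 1) → ℝ) {v : ℝ≥0 → Fin (N + 1) → ℝ} {L : ℝ}
    (hv : ∀ h, (1 - killedMatrix P d h).mulVec (v h) = exitVector (N + 1) P h)
    (hL : Tendsto (fun h => v h 0) (𝓝[>] 0) (𝓝 L)) :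
    (Matrix.diagonal d - upperBlock Q (N + 1)).det * L = (-upperBlock Q (N + 1)).det := by
  have h1 := tendsto_killedMatrix hP d
  have h2 := tendsto_exitVector (n := N + 1) hP
  have h3 := ((continuous_id.matrix_det.tendsto _).comp h1).mul hL
  have h4 : Tendsto (fun h : ℝ≥0 => (((h : ℝ)⁻¹ • (1 - killedMatrix P d h)).adjugate.mulVec
      ((h : ℝ)⁻¹ • exitVector (N + 1) P h)) 0) (𝓝[>] 0)
      (𝓝 (((Matrix.diagonal d - upperBlock Q (N + 1)).adjugate.mulVec
        (exitRate (N + 1) Q)) 0)) := by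
    have h5 := (continuous_id.matrix_adjugate.tendsto _).comp h1
    simp only [Matrix.mulVec, dotProduct]
    refine tendsto_finsetSum _ fun j _ => ?_
    exact (((continuous_id.matrix_elem 0 j).tendsto _).comp h5).mul
      (((continuous_apply j).tendsto _).comp h2)
  -- The adjugate replaces the inverse because D - Q_n is not yet known to be invertible.
  rw [adjugate_mulVec_exitRate hQ, ← det_neg_upperBlock hQ] at h4
  refine tendsto_nhds_unique h3 (h4.congr fun h => ?_)
  rw [← hv h, ← Matrix.smul_mulVec, Matrix.mulVec_mulVec, Matrix.adjugate_mul,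
    Matrix.smul_mulVec, Matrix.one_mulVec]
  rfl

end mesh

/-! ### Weights of paths observed on a grid -/

/-- The factor `e ^ (-d i * h)` in the states `i < n`, and `0` elsewhere. -/
noncomputable def killedWeight {n : ℕ} (d : Fin n → ℝ) (h : ℝ≥0) (y : ℕ∞) : ℝ≥0∞ :=
  ∑ i : Fin n, if y = (i : ℕ) then ENNReal.ofReal (Real.exp (-(d i * h))) else 0

/-- The product of the weights of the path `x` at the times `0, h, …, m * h`. -/
noncomputable def pathWeight {n : ℕ} (d : Fin n → ℝ) (h : ℝ≥0) (x : ℝ≥0 → ℕ∞) (m : ℕ) : ℝ≥0∞ :=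
  ∏ j ∈ Finset.range (m + 1), killedWeight d h (x (j * h))

/-- The weight of the path `x`, observed at the multiples of `h`, up to the time at which it leaves
`{0, …, n - 1}`, if it does so to `n`, and `0` otherwise. -/
noncomputable def gridFunctional {n : ℕ} (d : Fin n → ℝ) (h : ℝ≥0) (x : ℝ≥0 → ℕ∞) : ℝ≥0∞ :=
  ∑' m : ℕ, if x ((m + 1 : ℕ) * h) = n then pathWeight d h x m else 0

section weights

variable {n : ℕ} {d : Fin n → ℝ} {h : ℝ≥0} {x : ℝ≥0 → ℕ∞}

theorem killedWeight_coe (d : Fin n → ℝ) (h : ℝ≥0) (i : Fin n) :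
    killedWeight d h (i : ℕ) = ENNReal.ofReal (Real.exp (-(d i * h))) := by
  simp [killedWeight, ← Fin.ext_iff]

theorem killedWeight_of_le {y : ℕ∞} (hy : n ≤ y) : killedWeight d h y = 0 := by
  refine Finset.sum_eq_zero fun i _ => if_neg ?_
  rintro rfl
  exact absurd (Nat.cast_le.1 hy) (by omega)

theorem exists_fin_eq_of_lt {y : ℕ∞} (hy : y < n) : ∃ i : Fin n, y = (i : ℕ) := by
  lift y to ℕ using ne_top_of_lt hy
  exact ⟨⟨y, Nat.cast_lt.1 hy⟩, rfl⟩

theorem killedWeight_le_one (hd : ∀ i, 0 ≤ d i) (y : ℕ∞) : killedWeight d h y ≤ 1 := by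
  rcases lt_or_ge y n with hy | hy
  · obtain ⟨i, rfl⟩ := exists_fin_eq_of_lt hy
    rw [killedWeight_coe, ENNReal.ofReal_le_one, Real.exp_le_one_iff, neg_nonpos]
    exact mul_nonneg (hd i) h.2
  · simp [killedWeight_of_le hy]

theorem killedWeight_eq_sum (d : Fin n → ℝ) (h : ℝ≥0) (y : ℕ∞) :
    killedWeight d h y = ∑ i : Fin n, if y = (i : ℕ) then killedWeight d h y else 0 := by
  conv_lhs => rw [killedWeight]
  refine Finset.sum_congr rfl fun i _ => ?_
  split_ifs with hi
  · rw [hi, killedWeight_coe]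
  · rfl

theorem pathWeight_succ (d : Fin n → ℝ) (h : ℝ≥0) (x : ℝ≥0 → ℕ∞) (m : ℕ) :
    pathWeight d h x (m + 1) =
      pathWeight d h x m * killedWeight d h (x ((m + 1 : ℕ) * h)) :=
  Finset.prod_range_succ _ _

theorem pathWeight_eq_sum (d : Fin n → ℝ) (h : ℝ≥0) (x : ℝ≥0 → ℕ∞) (m : ℕ) :
    pathWeight d h x m =
      ∑ i : Fin n, if x (m * h) = (i : ℕ) then pathWeight d h x m else 0 := by
  have h1 : pathWeight d h x m =
      (∏ j ∈ Finset.range m, killedWeight d h (x (j * h))) * killedWeight d h (x (m * h)) :=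
    Finset.prod_range_succ _ _
  rw [h1]
  conv_lhs => rw [killedWeight_eq_sum, Finset.mul_sum]
  simp only [mul_ite, mul_zero]

/-- The last term is the weight still inside {0, …, n-1}. It can only decrease, and it vanishes on
arrival at n, when it is at most transferred to the sum. -/
theorem sum_range_add_pathWeight_le_one (hd : ∀ i, 0 ≤ d i) (M : ℕ) :
    ∑ m ∈ Finset.range M, (if x ((m + 1 : ℕ) * h) = n then pathWeight d h x m else 0) +
      pathWeight d h x M ≤ 1 := by
  induction M with
  | zero => simpa [pathWeight] using killedWeight_le_one hd _
  | succ M ih =>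
    refine le_trans ?_ ih
    rw [Finset.sum_range_succ, add_assoc]
    gcongr
    rw [pathWeight_succ]
    split_ifs with hM
    · rw [killedWeight_of_le hM.ge, mul_zero, add_zero]
    · rw [zero_add]
      exact mul_le_of_le_one_right' (killedWeight_le_one hd _)

theorem gridFunctional_le_one (hd : ∀ i, 0 ≤ d i) : gridFunctional d h x ≤ 1 :=
  ENNReal.tsum_le_of_sum_range_le fun M =>
    le_self_add.trans (sum_range_add_pathWeight_le_one hd M)

end weights

theorem measurable_past {Ω : Type*} {X : ℝ≥0 → Ω → ℕ∞} {r s : ℝ≥0} (hrs : r ≤ s) :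
    Measurable[past X s] (X r) :=
  Measurable.mono (comap_measurable (X r))
    (le_iSup (fun r : Set.Iic s => MeasurableSpace.comap (X r) inferInstance) ⟨r, hrs⟩) le_rfl

theorem measurable_pathWeight {Ω : Type*} {X : ℝ≥0 → Ω → ℕ∞} {n : ℕ} (d : Fin n → ℝ) (h : ℝ≥0)
    (m : ℕ) :
    Measurable[past X (m * h)] fun ω => pathWeight d h (fun t => X t ω) m := by
  refine Finset.measurable_fun_prod _ fun j hj => ?_
  refine (Measurable.of_discrete (f := killedWeight d h)).comp (measurable_past ?_)
  have : j ≤ m := by simpa [Nat.lt_succ_iff] using hj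
  gcongr

/-! ### Expectations of grid weights from the Markov property -/

section markov

variable {Ω : Type*} [mΩ : MeasurableSpace Ω] {μ : Measure Ω} {X : ℝ≥0 → Ω → ℕ∞}

theorem past_le (hX : ∀ t, Measurable (X t)) (s : ℝ≥0) : past X s ≤ mΩ :=
  iSup_le fun r => (hX r).comap_le

theorem measurableSet_eq_coe (hX : ∀ t, Measurable (X t)) (t : ℝ≥0) (j : ℕ) :
    MeasurableSet {ω | X t ω = j} :=
  hX t (MeasurableSet.of_discrete (s := {(j : ℕ∞)}))

theorem lintegral_ite_eq_coe (hX : ∀ t, Measurable (X t)) (ν : Measure Ω) (t : ℝ≥0) (j : ℕ)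
    (f : Ω → ℝ≥0∞) :
    ∫⁻ ω, (if X t ω = j then f ω else 0) ∂ν = ∫⁻ ω in {ω | X t ω = j}, f ω ∂ν := by
  rw [← lintegral_indicator (measurableSet_eq_coe hX t j)]
  simp only [Set.indicator_apply, Set.mem_ofPred_eq]

theorem measurable_gridFunctional (hX : ∀ t, Measurable (X t)) {n : ℕ} (d : Fin n → ℝ) (h : ℝ≥0) :
    Measurable fun ω => gridFunctional d h (fun t => X t ω) :=
  Measurable.tsum fun m => Measurable.ite (measurableSet_eq_coe hX _ _)
    ((measurable_pathWeight d h m).mono (past_le hX _) le_rfl) measurable_const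

/-- The hypothesis is an equality of two measures on the past σ-algebra, so it extends from sets to
integrals. -/
theorem setLIntegral_of_markov (hX : ∀ t, Measurable (X t)) {s t : ℝ≥0} {i j : ℕ} {p : ℝ≥0∞}
    (hp : ∀ A : Set Ω, MeasurableSet[past X s] A →
      μ (A ∩ {ω | X s ω = i} ∩ {ω | X (s + t) ω = j}) = μ (A ∩ {ω | X s ω = i}) * p)
    {f : Ω → ℝ≥0∞} (hf : Measurable[past X s] f) :
    ∫⁻ ω in {ω | X s ω = i} ∩ {ω | X (s + t) ω = j}, f ω ∂μ =
      (∫⁻ ω in {ω | X s ω = i}, f ω ∂μ) * p := by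
  have hm := past_le hX s
  rw [← lintegral_trim hm hf, ← lintegral_trim hm hf, mul_comm, ← smul_eq_mul,
    ← lintegral_smul_measure]
  congr 1
  refine @Measure.ext _ (past X s) _ _ fun A hA => ?_
  rw [Measure.smul_apply, trim_measurableSet_eq hm hA, trim_measurableSet_eq hm hA,
    Measure.restrict_apply (hm _ hA), Measure.restrict_apply (hm _ hA), ← Set.inter_assoc,
    hp A hA, smul_eq_mul, mul_comm]

theorem setLIntegral_pathWeight_eq_sum (hX : ∀ t, Measurable (X t)) {n : ℕ} (d : Fin n → ℝ)
    {h : ℝ≥0} {P : ℝ≥0 → Matrix ℕ ℕ ℝ}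
    (hP : ∀ (s t : ℝ≥0) (i j : ℕ) (A : Set Ω), MeasurableSet[past X s] A →
      μ (A ∩ {ω | X s ω = i} ∩ {ω | X (s + t) ω = j}) =
        μ (A ∩ {ω | X s ω = i}) * ENNReal.ofReal (P t i j)) (m k : ℕ) :
    ∫⁻ ω in {ω | X ((m + 1 : ℕ) * h) ω = k}, pathWeight d h (fun t => X t ω) m ∂μ =
      ∑ i : Fin n, (∫⁻ ω in {ω | X (m * h) ω = (i : ℕ)}, pathWeight d h (fun t => X t ω) m ∂μ) *
        ENNReal.ofReal (P h i k) := by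
  have h1 : ((m + 1 : ℕ) : ℝ≥0) * h = m * h + h := by push_cast; ring
  have hW := measurable_pathWeight (X := X) d h m
  have hW' := hW.mono (past_le hX _) le_rfl
  simp_rw [← setLIntegral_of_markov hX (hP (m * h) h _ k) hW, h1]
  conv_lhs =>
    enter [2, ω]
    rw [pathWeight_eq_sum]
  rw [lintegral_finsetSum _ fun i _ =>
    Measurable.ite (measurableSet_eq_coe hX _ _) hW' measurable_const]
  refine Finset.sum_congr rfl fun i _ => ?_
  rw [← Measure.restrict_restrict (measurableSet_eq_coe hX _ _), lintegral_ite_eq_coe hX]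

theorem killedMatrix_pow_nonneg {n : ℕ} {P : ℝ≥0 → Matrix ℕ ℕ ℝ} {Q : Matrix ℕ ℕ ℝ}
    (hPQ : IsTransitionFunction P Q) (d : Fin n → ℝ) (h : ℝ≥0) (m : ℕ) :
    ∀ i j, 0 ≤ (killedMatrix P d h ^ m) i j := by
  induction m with
  | zero => intro i j; rw [pow_zero, Matrix.one_apply]; split_ifs <;> norm_num
  | succ m ih =>
    intro i j
    rw [pow_succ, Matrix.mul_apply]
    exact Finset.sum_nonneg fun k _ => mul_nonneg (ih i k) (killedMatrix_nonneg hPQ d h k j)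

/-- Each matrix factor carries the weight of its arrival state, so the m-th power misses only the
weight at time 0, which is the extra exponential. -/
theorem setLIntegral_pathWeight [IsProbabilityMeasure μ] {Q : Matrix ℕ ℕ ℝ}
    (hX : ∀ t, Measurable (X t)) (h0 : ∀ᵐ ω ∂μ, X 0 ω = (0 : ℕ)) {N : ℕ} (d : Fin (N + 1) → ℝ)
    {h : ℝ≥0} {P : ℝ≥0 → Matrix ℕ ℕ ℝ} (hPQ : IsTransitionFunction P Q)
    (hP : ∀ (s t : ℝ≥0) (i j : ℕ) (A : Set Ω), MeasurableSet[past X s] A →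
      μ (A ∩ {ω | X s ω = i} ∩ {ω | X (s + t) ω = j}) =
        μ (A ∩ {ω | X s ω = i}) * ENNReal.ofReal (P t i j)) (m : ℕ) (j : Fin (N + 1)) :
    ∫⁻ ω in {ω | X (m * h) ω = (j : ℕ)}, pathWeight d h (fun t => X t ω) m ∂μ =
      ENNReal.ofReal (Real.exp (-(d 0 * h)) * (killedMatrix P d h ^ m) 0 j) := by
  have hA := killedMatrix_pow_nonneg hPQ d h
  have hms := measurableSet_eq_coe hX
  induction m generalizing j with
  | zero =>
    simp only [pathWeight, Nat.cast_zero, zero_mul, zero_add, Finset.prod_range_one, pow_zero]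
    rcases eq_or_ne j 0 with rfl | hj
    · rw [setLIntegral_congr_fun (g := fun _ => ENNReal.ofReal (Real.exp (-(d 0 * h)))) (hms _ _)
        (fun ω hω => by
          have hω : X 0 ω = ((0 : Fin (N + 1)) : ℕ) := hω
          simp only [hω, killedWeight_coe]),
        setLIntegral_const, (prob_compl_eq_zero_iff (hms _ _)).1]
      · simp
      · exact h0
    · rw [Matrix.one_apply_ne hj.symm, mul_zero, ENNReal.ofReal_zero]
      refine setLIntegral_measure_zero _ _ (measure_mono_null (fun ω hω => ?_) h0)
      have hω : X 0 ω = (j : ℕ) := hω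
      intro h2
      exact hj (Fin.ext (Nat.cast_injective (hω.symm.trans h2)))
  | succ m ih =>
    rw [setLIntegral_congr_fun (g := fun ω => pathWeight d h (fun t => X t ω) m *
      ENNReal.ofReal (Real.exp (-(d j * h)))) (hms _ _)
      (fun ω hω => by
        have hω : X ((m + 1 : ℕ) * h) ω = (j : ℕ) := hω
        simp only [pathWeight_succ, hω, killedWeight_coe]),
      lintegral_mul_const' _ _ ENNReal.ofReal_ne_top, setLIntegral_pathWeight_eq_sum hX d hP]
    simp only [ih]
    have hnn := fun i => mul_nonneg (mul_nonneg (Real.exp_pos (-(d 0 * h))).le (hA m 0 i))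
      (hPQ.nonneg h i j)
    simp only [← ENNReal.ofReal_mul (mul_nonneg (Real.exp_pos (-(d 0 * h))).le (hA m 0 _))]
    rw [← ENNReal.ofReal_sum_of_nonneg fun i _ => hnn i,
      ← ENNReal.ofReal_mul (Finset.sum_nonneg fun i _ => hnn i), pow_succ, Matrix.mul_apply,
      Finset.sum_mul, Finset.mul_sum]
    congr 1
    refine Finset.sum_congr rfl fun i _ => ?_
    simp only [killedMatrix, Matrix.of_apply]
    ring

theorem lintegral_gridFunctional [IsProbabilityMeasure μ] {Q : Matrix ℕ ℕ ℝ}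
    (hX : ∀ t, Measurable (X t)) (h0 : ∀ᵐ ω ∂μ, X 0 ω = (0 : ℕ)) {N : ℕ} (d : Fin (N + 1) → ℝ)
    {h : ℝ≥0} {P : ℝ≥0 → Matrix ℕ ℕ ℝ} (hPQ : IsTransitionFunction P Q)
    (hP : ∀ (s t : ℝ≥0) (i j : ℕ) (A : Set Ω), MeasurableSet[past X s] A →
      μ (A ∩ {ω | X s ω = i} ∩ {ω | X (s + t) ω = j}) =
        μ (A ∩ {ω | X s ω = i}) * ENNReal.ofReal (P t i j)) {w : ℝ}
    (hw : HasSum (fun m : ℕ => ((killedMatrix P d h ^ m).mulVec (exitVector (N + 1) P h)) 0) w) :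
    ∫⁻ ω, gridFunctional d h (fun t => X t ω) ∂μ =
      ENNReal.ofReal (Real.exp (-(d 0 * h)) * w) := by
  have hms := measurableSet_eq_coe hX
  have hA := killedMatrix_pow_nonneg hPQ d h
  have hterm : ∀ m : ℕ, ∫⁻ ω, (if X ((m + 1 : ℕ) * h) ω = (N + 1 : ℕ) then
      pathWeight d h (fun t => X t ω) m else 0) ∂μ = ENNReal.ofReal (Real.exp (-(d 0 * h)) *
        ((killedMatrix P d h ^ m).mulVec (exitVector (N + 1) P h)) 0) := by
    intro m
    have h1 := setLIntegral_pathWeight_eq_sum hX d (h := h) hP m (N + 1)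
    rw [← lintegral_ite_eq_coe hX] at h1
    refine h1.trans ?_
    simp only [setLIntegral_pathWeight hX h0 d hPQ hP,
        ← ENNReal.ofReal_mul (mul_nonneg (Real.exp_pos (-(d 0 * h))).le (hA m 0 _))]
    rw [← ENNReal.ofReal_sum_of_nonneg fun i _ =>
        mul_nonneg (mul_nonneg (Real.exp_pos _).le (hA m 0 i)) (hPQ.nonneg h i (N + 1))]
    simp only [Matrix.mulVec, dotProduct, Finset.mul_sum, exitVector, mul_assoc]
  simp only [gridFunctional]
  rw [lintegral_tsum fun m => (Measurable.ite (hms _ _)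
    ((measurable_pathWeight d h m).mono (past_le hX _) le_rfl) measurable_const).aemeasurable]
  simp only [hterm]
  have hw' := hw.mul_left (Real.exp (-(d 0 * h)))
  rw [← hw'.tsum_eq, ENNReal.ofReal_tsum_of_nonneg _ hw'.summable]
  intro m
  refine mul_nonneg (Real.exp_pos _).le ?_
  simp only [Matrix.mulVec, dotProduct]
  exact Finset.sum_nonneg fun i _ => mul_nonneg (hA m 0 i) (hPQ.nonneg h i (N + 1))

end markov

/-! ### Pathwise convergence along right-continuous paths -/

section paths

variable {n : ℕ} {x : ℝ≥0 → ℕ∞}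

theorem eventually_eq_coe_iff (hx : ∀ t, ContinuousWithinAt x (Set.Ici t) t) (t : ℝ≥0) (i : ℕ) :
    ∀ᶠ s in 𝓝[≥] t, (x s = i ↔ x t = i) := by
  by_cases h : x t = i
  · have h1 : {(i : ℕ∞)} ∈ 𝓝 (x t) := by
      rw [h]
      exact (ENat.isOpen_singleton (ENat.natCast_ne_top i)).mem_nhds rfl
    filter_upwards [hx t h1] with s hs
    exact ⟨fun _ => h, fun _ => hs⟩
  · have h1 : {(i : ℕ∞)}ᶜ ∈ 𝓝 (x t) := isOpen_compl_singleton.mem_nhds h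
    filter_upwards [hx t h1] with s hs
    exact ⟨fun h2 => absurd h2 hs, fun h2 => absurd h2 h⟩

theorem eventually_le_iff (hx : ∀ t, ContinuousWithinAt x (Set.Ici t) t) (t : ℝ≥0) (n : ℕ) :
    ∀ᶠ s in 𝓝[≥] t, (x s < n ↔ x t < n) := by
  have h1 : ∀ y : ℕ∞, y < n ↔ ∃ i : Fin n, y = (i : ℕ) := fun y =>
    ⟨exists_fin_eq_of_lt, by rintro ⟨i, rfl⟩; exact Nat.cast_lt.2 i.2⟩
  simp only [h1]
  filter_upwards [eventually_all.2 fun i : Fin n => eventually_eq_coe_iff hx t i] with s hs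
  exact exists_congr hs

theorem exists_first_exit (hx : ∀ t, ContinuousWithinAt x (Set.Ici t) t)
    (hexit : ∃ t, (n : ℕ∞) ≤ x t) : ∃ σ, (n : ℕ∞) ≤ x σ ∧ ∀ s < σ, x s < n := by
  set S := {t | (n : ℕ∞) ≤ x t}
  have hS : S.Nonempty := hexit
  refine ⟨sInf S, ?_, fun s hs => not_le.1 fun h => (csInf_le' (s := S) h).not_gt hs⟩
  have h1 := mem_closure_iff_frequently.1 (csInf_mem_closure hS (OrderBot.bddBelow S))
  obtain ⟨s, hs, h2⟩ :=
    (h1.and_eventually (eventually_nhdsWithin_iff.1 (eventually_le_iff hx (sInf S) n))).exists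
  exact not_lt.1 fun h => (not_lt.2 hs) ((h2 (csInf_le' hs)).2 h)

/-- The first grid time not before t approaches t from the right, the side on which the paths are
continuous. -/
theorem tendsto_ceil_div_mul (t : ℝ≥0) :
    Tendsto (fun h : ℝ≥0 => (⌈t / h⌉₊ : ℝ≥0) * h) (𝓝[>] 0) (𝓝[≥] t) := by
  have h0 : ∀ᶠ h : ℝ≥0 in 𝓝[>] 0, t ≤ (⌈t / h⌉₊ : ℝ≥0) * h := by
    filter_upwards [self_mem_nhdsWithin] with h (hh : 0 < h)
    exact (div_le_iff₀ hh).1 (Nat.le_ceil _)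
  refine tendsto_nhdsWithin_iff.2 ⟨?_, h0⟩
  refine tendsto_of_tendsto_of_tendsto_of_le_of_le' tendsto_const_nhds
    (h := fun h => t + h) ?_ h0 ?_
  · refine Tendsto.mono_left ?_ nhdsWithin_le_nhds
    exact (continuous_const.add continuous_id).tendsto' _ _ (by simp)
  · filter_upwards [self_mem_nhdsWithin] with h (hh : 0 < h)
    have := (Nat.ceil_lt_add_one (zero_le (a := t / h))).le
    calc (⌈t / h⌉₊ : ℝ≥0) * h ≤ (t / h + 1) * h := by gcongr
      _ = t + h := by rw [add_mul, div_mul_cancel₀ _ hh.ne', one_mul]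

theorem mem_Ioc_grid_iff {h : ℝ≥0} (hh : 0 < h) (s : ℝ) (j : ℕ) :
    s ∈ Set.Ioc (((j : ℝ) - 1) * h) (j * h) ↔ -(h : ℝ) < s ∧ ⌈s.toNNReal / h⌉₊ = j := by
  have hh' : (0 : ℝ) < h := hh
  rcases lt_or_ge s 0 with hs | hs
  · rw [Real.toNNReal_of_nonpos hs.le, zero_div, Nat.ceil_zero]
    rcases Nat.eq_zero_or_pos j with rfl | hj
    · simp [hs.le]
    · have hj' : (1 : ℝ) ≤ j := by exact_mod_cast hj
      constructor
      · rintro ⟨h1, -⟩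
        have := mul_nonneg (sub_nonneg.2 hj') hh'.le
        linarith
      · rintro ⟨-, h1⟩
        omega
  · lift s to ℝ≥0 using hs
    rw [Real.toNNReal_coe, and_iff_right (by linarith [s.2] : -(h : ℝ) < s)]
    rcases j with _ | k
    · simp only [Nat.ceil_eq_zero, Set.mem_Ioc, CharP.cast_eq_zero, zero_sub, zero_mul]
      rw [div_le_iff₀ hh, zero_mul]
      constructor
      · exact fun h1 => h1.2
      · exact fun h1 => ⟨by linarith [s.2], h1⟩
    · rw [Nat.ceil_eq_iff (Nat.succ_ne_zero k), Nat.succ_sub_one, lt_div_iff₀ hh,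
        div_le_iff₀ hh, Set.mem_Ioc]
      push_cast
      rw [add_sub_cancel_right]
      norm_cast

theorem tendsto_sum_occupation (hx : ∀ t, ContinuousWithinAt x (Set.Ici t) t) (σ : ℝ≥0) (i : ℕ) :
    Tendsto (fun h : ℝ≥0 =>
        ∑ j ∈ Finset.range ⌈σ / h⌉₊, if x (j * h) = i then (h : ℝ≥0∞) else 0) (𝓝[>] 0)
      (𝓝 (∫⁻ s in {s : ℝ | 0 ≤ s ∧ ENNReal.ofReal s < σ},
        Set.indicator {s : ℝ | x s.toNNReal = i} 1 s)) := by
  have hset : {s : ℝ | 0 ≤ s ∧ ENNReal.ofReal s < σ} = Set.Ico 0 (σ : ℝ) := by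
    ext s
    refine and_congr_right fun hs => ?_
    rw [← ENNReal.ofReal_coe_nnreal, ENNReal.ofReal_lt_ofReal_iff_of_nonneg hs]
  rw [hset, ← lintegral_indicator measurableSet_Ico]
  -- The sum is the integral of a step function. Cells closed on the right make its value at s
  -- depend on the path at the next grid time.
  let Φ : ℝ≥0 → ℝ → ℝ≥0∞ := fun h s => ∑ j ∈ Finset.range ⌈σ / h⌉₊,
    Set.indicator (Set.Ioc (((j : ℝ) - 1) * h) (j * h)) (fun _ => if x (j * h) = i then 1 else 0) s
  have hΦint : ∀ h : ℝ≥0, ∫⁻ s, Φ h s =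
      ∑ j ∈ Finset.range ⌈σ / h⌉₊, if x (j * h) = i then (h : ℝ≥0∞) else 0 := by
    intro h
    simp only [Φ]
    rw [lintegral_finsetSum _ fun j _ => measurable_const.indicator measurableSet_Ioc]
    refine Finset.sum_congr rfl fun j _ => ?_
    rw [lintegral_indicator_const measurableSet_Ioc, Real.volume_Ioc,
      show (j : ℝ) * h - ((j : ℝ) - 1) * h = h by ring, ENNReal.ofReal_coe_nnreal]
    split_ifs <;> simp
  have hΦ : ∀ h : ℝ≥0, 0 < h → ∀ s, Φ h s =
      if -(h : ℝ) < s ∧ ⌈s.toNNReal / h⌉₊ < ⌈σ / h⌉₊ ∧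
        x (⌈s.toNNReal / h⌉₊ * h) = i then 1 else 0 := by
    intro h hh s
    simp only [Φ, Set.indicator_apply, mem_Ioc_grid_iff hh]
    by_cases hs : -(h : ℝ) < s
    · simp only [hs, true_and, Finset.sum_ite_eq, Finset.mem_range, ite_and]
    · simp [hs]
  refine Tendsto.congr hΦint ?_
  refine tendsto_lintegral_filter_of_dominated_convergence
    -- The cell j = 0 is (-h, 0], so the dominating interval has to reach below 0; -1 suffices for h
    -- < 1.
    (Set.indicator (Set.Ioc (-1) (σ : ℝ)) 1) ?_ ?_ ?_ ?_
  · exact Eventually.of_forall fun h => Finset.measurable_fun_sum _ fun j _ =>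
      measurable_const.indicator measurableSet_Ioc
  · have h1 : ∀ᶠ h : ℝ≥0 in 𝓝[>] 0, h < 1 := nhdsWithin_le_nhds (Iio_mem_nhds one_pos)
    filter_upwards [h1, self_mem_nhdsWithin] with h h1 (hh : 0 < h)
    refine Eventually.of_forall fun s => ?_
    rw [hΦ h hh]
    split_ifs with hs
    · rw [Set.indicator_of_mem, Pi.one_apply]
      have h1' : (h : ℝ) < 1 := h1
      refine ⟨by linarith [hs.1], not_lt.1 fun h2 => hs.2.1.not_ge ?_⟩
      have : σ ≤ s.toNNReal := Real.toNNReal_coe (r := σ) ▸ Real.toNNReal_mono h2.le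
      gcongr
    · exact zero_le
  · rw [lintegral_indicator_one measurableSet_Ioc, Real.volume_Ioc]
    exact ENNReal.ofReal_ne_top
  · refine Eventually.of_forall fun s => tendsto_nhds_of_eventually_eq ?_
    rcases lt_or_ge s 0 with hs | hs
    · have h1 : ∀ᶠ h : ℝ≥0 in 𝓝[>] 0, (h : ℝ) < -s :=
        tendsto_coe_nhdsGT_zero.eventually (Iio_mem_nhds (neg_pos.2 hs))
      filter_upwards [h1, self_mem_nhdsWithin] with h h1 (hh : 0 < h)
      rw [hΦ h hh, if_neg fun h2 => by linarith [h2.1], Set.indicator_of_notMem]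
      exact fun h2 => hs.not_ge h2.1
    · lift s to ℝ≥0 using hs
      rcases lt_or_ge s σ with hs | hs
      · have h2 := tendsto_ceil_div_mul s
        filter_upwards [h2.eventually (eventually_eq_coe_iff hx s i),
          h2.eventually (nhdsWithin_le_nhds (Iio_mem_nhds hs)), self_mem_nhdsWithin]
          with h h3 h4 (hh : 0 < h)
        rw [hΦ h hh, Set.indicator_of_mem (show (s : ℝ) ∈ Set.Ico 0 (σ : ℝ) from ⟨s.2, hs⟩)]
        have h5 : ⌈s / h⌉₊ < ⌈σ / h⌉₊ := Nat.lt_ceil.2 ((lt_div_iff₀ hh).2 h4)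
        have h6 : -(h : ℝ) < s := (neg_neg_of_pos (NNReal.coe_pos.2 hh)).trans_le s.2
        simp only [Real.toNNReal_coe, h3, h5, h6, true_and, Set.indicator_apply,
          Set.mem_ofPred_eq, Pi.one_apply]
      · filter_upwards [self_mem_nhdsWithin] with h (hh : 0 < h)
        rw [hΦ h hh, Set.indicator_of_notMem fun h2 => (not_lt.2 hs) h2.2, if_neg]
        rintro ⟨-, h2, -⟩
        refine h2.not_ge ?_
        rw [Real.toNNReal_coe]
        gcongr

theorem occupation_lt_top (x : ℝ≥0 → ℕ∞) (σ : ℝ≥0) (i : ℕ) :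
    ∫⁻ s in {s : ℝ | 0 ≤ s ∧ ENNReal.ofReal s < σ},
      Set.indicator {s : ℝ | x s.toNNReal = i} 1 s < ∞ := by
  refine (lintegral_mono (g := fun _ => 1) fun s => ?_).trans_lt ?_
  · exact Set.indicator_le_self' (fun _ _ => zero_le) s
  · rw [setLIntegral_one]
    refine (measure_mono (t := Set.Icc 0 (σ : ℝ)) fun s hs => ⟨hs.1, ?_⟩).trans_lt
      measure_Icc_lt_top
    have := hs.2.le
    rw [← ENNReal.ofReal_coe_nnreal] at this
    exact (ENNReal.ofReal_le_ofReal_iff σ.2).1 this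

theorem killedWeight_of_lt (d : Fin n → ℝ) (h : ℝ≥0) {y : ℕ∞} (hy : y < n) :
    killedWeight d h y = ENNReal.ofReal (Real.exp
      (-∑ i : Fin n, d i * (if y = (i : ℕ) then (h : ℝ≥0∞) else 0).toReal)) := by
  obtain ⟨i, rfl⟩ := exists_fin_eq_of_lt hy
  rw [killedWeight_coe, Finset.sum_eq_single i]
  · simp
  · intro j _ hj
    rw [if_neg, ENNReal.toReal_zero, mul_zero]
    exact fun h => hj (Fin.ext (Nat.cast_injective h)).symm
  · simp

theorem prod_killedWeight (d : Fin n → ℝ) (h : ℝ≥0) (M : ℕ) (hM : ∀ j < M, x (j * h) < n) :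
    ∏ j ∈ Finset.range M, killedWeight d h (x (j * h)) = ENNReal.ofReal (Real.exp
      (-∑ i : Fin n, d i *
        (∑ j ∈ Finset.range M, if x (j * h) = (i : ℕ) then (h : ℝ≥0∞) else 0).toReal)) := by
  rw [Finset.prod_congr rfl fun j hj => killedWeight_of_lt d h (hM j (Finset.mem_range.1 hj)),
    ← ENNReal.ofReal_prod_of_nonneg fun _ _ => (Real.exp_pos _).le, ← Real.exp_sum,
    Finset.sum_neg_distrib, Finset.sum_comm]
  simp only [← Finset.mul_sum]
  congr 4
  ext i
  rw [ENNReal.toReal_sum]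
  intro j _
  split_ifs <;> simp

/-- Only the term m = M - 1 survives: earlier ones need a visit to n before grid time M, and later
ones contain the zero weight at grid time M. -/
theorem gridFunctional_eq_of_exit (d : Fin n → ℝ) {h : ℝ≥0} {M : ℕ} (hM0 : 0 < M)
    (hM : ∀ j < M, x (j * h) < n) (hexit : (n : ℕ∞) ≤ x (M * h)) :
    gridFunctional d h x =
      if x (M * h) = n then ∏ j ∈ Finset.range M, killedWeight d h (x (j * h)) else 0 := by
  obtain ⟨m, rfl⟩ := Nat.exists_eq_succ_of_ne_zero hM0.ne'
  rw [gridFunctional, tsum_eq_single m]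
  · rfl
  · intro k hk
    rcases lt_or_gt_of_ne hk with hk | hk
    · exact if_neg (hM (k + 1) (by omega)).ne
    · rw [pathWeight, Finset.prod_eq_zero (i := m + 1) (Finset.mem_range.2 (by omega))
        (killedWeight_of_le hexit), ite_self]

theorem tendsto_gridFunctional (hx : ∀ t, ContinuousWithinAt x (Set.Ici t) t) (d : Fin n → ℝ)
    {σ : ℝ≥0} (hσ : 0 < σ) (hlt : ∀ s < σ, x s < n) (hexit : (n : ℕ∞) ≤ x σ) :
    Tendsto (fun h => gridFunctional d h x) (𝓝[>] 0)
      (𝓝 (if x σ = n then ENNReal.ofReal (Real.exp (-∑ i : Fin n, d i *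
        (∫⁻ s in {s : ℝ | 0 ≤ s ∧ ENNReal.ofReal s < σ},
          Set.indicator {s : ℝ | x s.toNNReal = (i : ℕ)} 1 s).toReal)) else 0)) := by
  have h1 : ∀ᶠ h : ℝ≥0 in 𝓝[>] 0, (if x σ = n then ENNReal.ofReal (Real.exp
      (-∑ i : Fin n, d i * (∑ j ∈ Finset.range ⌈σ / h⌉₊,
        if x (j * h) = (i : ℕ) then (h : ℝ≥0∞) else 0).toReal)) else 0) =
      gridFunctional d h x := by
    have h2 := tendsto_ceil_div_mul σ
    filter_upwards [h2.eventually (eventually_eq_coe_iff hx σ n),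
      h2.eventually (eventually_le_iff hx σ n), self_mem_nhdsWithin] with h h3 h4 (hh : 0 < h)
    have h5 : ∀ j < ⌈σ / h⌉₊, x (j * h) < n := fun j hj =>
      hlt _ ((lt_div_iff₀ hh).1 (Nat.lt_ceil.1 hj))
    rw [gridFunctional_eq_of_exit d (Nat.ceil_pos.2 (div_pos hσ hh)) h5
      (not_lt.1 fun h6 => (not_lt.2 hexit) (h4.1 h6)), prod_killedWeight d h _ h5]
    simp only [h3]
  refine Tendsto.congr' h1 ?_
  split_ifs
  · refine (ENNReal.continuous_ofReal.tendsto _).comp ((Real.continuous_exp.tendsto _).comp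
      (tendsto_finsetSum _ fun i _ => Tendsto.const_mul _ ?_).neg)
    exact (ENNReal.tendsto_toReal (occupation_lt_top x σ i).ne).comp
      (tendsto_sum_occupation hx σ i)
  · exact tendsto_const_nhds

end paths

/-! ### Passage to the limit and almost sure exit into n -/

section limit

variable {Ω : Type*} {X : ℝ≥0 → Ω → ℕ∞}

/-- The paths that leave `{0, …, n - 1}` by a transition to `n`. -/
def exitsTo (X : ℝ≥0 → Ω → ℕ∞) (n : ℕ) : Set Ω :=
  {ω | ∃ σ : ℝ≥0, X σ ω = n ∧ ∀ s < σ, X s ω < n}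

open Classical in
/-- The exponential of the weighted occupation times, on the event `exitsTo X n`. -/
noncomputable def exitFunctional {n : ℕ} (X : ℝ≥0 → Ω → ℕ∞) (d : Fin n → ℝ) (ω : Ω) : ℝ≥0∞ :=
  if ω ∈ exitsTo X n then ENNReal.ofReal (Real.exp (-∑ i : Fin n, d i *
    (occupationTime X i (hittingTime X n ω) ω).toReal)) else 0

theorem hittingTime_eq {n : ℕ} {ω : Ω} {σ : ℝ≥0} (hσ : X σ ω = n) (hlt : ∀ s < σ, X s ω < n) :
    hittingTime X n ω = σ := by
  refine le_antisymm (iInf₂_le σ hσ) (le_iInf₂ fun t ht => ?_)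
  exact ENNReal.coe_le_coe.2 (not_lt.1 fun h => (hlt t h).ne ht)

theorem hittingTime_zero {ω : Ω} (h0 : X 0 ω = (0 : ℕ)) : hittingTime X 0 ω = 0 := by
  simpa using hittingTime_eq h0 fun s hs => absurd hs not_lt_zero

theorem hittingTime_lt_top {n : ℕ} {ω : Ω} (hω : ω ∈ exitsTo X n) : hittingTime X n ω < ∞ := by
  obtain ⟨σ, hσ, hlt⟩ := hω
  rw [hittingTime_eq hσ hlt]
  exact ENNReal.coe_lt_top

theorem occupationTime_lt_top {n : ℕ} {ω : Ω} (hω : ω ∈ exitsTo X n) (i : ℕ) :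
    occupationTime X i (hittingTime X n ω) ω < ∞ := by
  obtain ⟨σ, hσ, hlt⟩ := hω
  rw [hittingTime_eq hσ hlt]
  exact occupation_lt_top (fun t => X t ω) σ i

theorem tendsto_gridFunctional_exitFunctional {n : ℕ} (hn : 0 < n) {ω : Ω}
    (hω : ∀ t, ContinuousWithinAt (fun s => X s ω) (Set.Ici t) t) (h0 : X 0 ω = (0 : ℕ))
    (d : Fin n → ℝ) :
    Tendsto (fun h => gridFunctional d h (fun t => X t ω)) (𝓝[>] 0)
      (𝓝 (exitFunctional X d ω)) := by
  by_cases hex : ∃ t, (n : ℕ∞) ≤ X t ω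
  · obtain ⟨σ, hσ, hlt⟩ := exists_first_exit hω hex
    have hσ0 : 0 < σ := by
      refine pos_iff_ne_zero.2 ?_
      rintro rfl
      rw [h0] at hσ
      exact absurd (Nat.cast_le.1 hσ) hn.not_ge
    have hiff : ω ∈ exitsTo X n ↔ X σ ω = n := by
      refine ⟨?_, fun h => ⟨σ, h, hlt⟩⟩
      rintro ⟨τ, hτ, hlt'⟩
      rcases lt_trichotomy σ τ with h | rfl | h
      · exact absurd (hlt' σ h) hσ.not_gt
      · exact hτ
      · exact absurd hτ (hlt τ h).ne
    convert tendsto_gridFunctional hω d hσ0 hlt hσ using 2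
    rw [exitFunctional]
    by_cases h : X σ ω = n
    · rw [if_pos (hiff.2 h), if_pos h, hittingTime_eq h hlt]
      rfl
    · rw [if_neg (mt hiff.1 h), if_neg h]
  · push Not at hex
    have h1 : exitFunctional X d ω = 0 := by
      refine if_neg ?_
      rintro ⟨σ, hσ, -⟩
      exact (hex σ).ne hσ
    have h2 : ∀ h, gridFunctional d h (fun t => X t ω) = 0 := fun h =>
      ENNReal.tsum_eq_zero.2 fun m => if_neg (hex _).ne
    simp only [h1, h2, tendsto_const_nhds]

theorem exitFunctional_le_one {n : ℕ} {d : Fin n → ℝ} (hd : ∀ i, 0 ≤ d i) (ω : Ω) :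
    exitFunctional X d ω ≤ 1 := by
  rw [exitFunctional]
  split_ifs
  · rw [ENNReal.ofReal_le_one, Real.exp_le_one_iff, neg_nonpos]
    exact Finset.sum_nonneg fun i _ => mul_nonneg (hd i) ENNReal.toReal_nonneg
  · exact zero_le

variable [MeasurableSpace Ω] {μ : Measure Ω} {Q : Matrix ℕ ℕ ℝ}

/-- The exit event involves uncountably many times; measurability is inherited from the almost
everywhere limit of the grid functionals. -/
theorem aemeasurable_exitFunctional (hX : IsMarkovProcess μ X Q 0) {n : ℕ} (hn : 0 < n)
    (d : Fin n → ℝ) : AEMeasurable (exitFunctional X d) μ := by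
  refine aemeasurable_of_tendsto_metrizable_ae (𝓝[>] (0 : ℝ≥0))
    (fun h => (measurable_gridFunctional hX.measurable d h).aemeasurable) ?_
  filter_upwards [hX.start, hX.rightContinuous] with ω h0 hω
  exact tendsto_gridFunctional_exitFunctional hn hω h0 d

theorem det_mul_lintegral_exitFunctional [IsProbabilityMeasure μ] (hQ : IsSkipFree Q)
    (hX : IsMarkovProcess μ X Q 0)
    {N : ℕ} {d : Fin (N + 1) → ℝ} (hd : ∀ i, 0 ≤ d i) :
    (Matrix.diagonal d - upperBlock Q (N + 1)).det * (∫⁻ ω, exitFunctional X d ω ∂μ).toReal =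
      (-upperBlock Q (N + 1)).det := by
  obtain ⟨P, hPQ, hP⟩ := hX.markov
  have hlim : Tendsto (fun h => ∫⁻ ω, gridFunctional d h (fun t => X t ω) ∂μ) (𝓝[>] 0)
      (𝓝 (∫⁻ ω, exitFunctional X d ω ∂μ)) := by
    refine tendsto_lintegral_filter_of_dominated_convergence (fun _ => 1)
      (Eventually.of_forall fun h => measurable_gridFunctional hX.measurable d h)
      (Eventually.of_forall fun h => Eventually.of_forall fun ω => gridFunctional_le_one hd)
      (by simp) ?_
    filter_upwards [hX.start, hX.rightContinuous] with ω h0 hω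
    exact tendsto_gridFunctional_exitFunctional N.succ_pos hω h0 d
  have hne : ∫⁻ ω, exitFunctional X d ω ∂μ ≠ ∞ := by
    refine ((lintegral_mono (exitFunctional_le_one hd)).trans_lt ?_).ne
    simp
  choose v hv hv' using fun h : ℝ≥0 => exists_hasSum_pow_mulVec (killedMatrix P d h)
    (exitVector (N + 1) P h) (killedMatrix_nonneg hPQ d h) (fun i => hPQ.nonneg h i (N + 1))
    (exitVector_add_sum_killedMatrix_le hPQ hd h)
  refine det_mul_eq_of_tendsto hQ hPQ d hv' ?_
  -- Divide out the weight at time 0, which tends to 1.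
  have h1 := ((ENNReal.tendsto_toReal hne).comp hlim).div (tendsto_exp_neg_mul (d 0)) one_ne_zero
  rw [div_one] at h1
  refine h1.congr fun h => ?_
  have hv0 : 0 ≤ v h 0 := (hv h 0).nonneg fun m => by
    simp only [Matrix.mulVec, dotProduct]
    exact Finset.sum_nonneg fun i _ =>
      mul_nonneg (killedMatrix_pow_nonneg hPQ d h m 0 i) (hPQ.nonneg h i (N + 1))
  rw [Pi.div_apply, Function.comp_apply,
    lintegral_gridFunctional hX.measurable hX.start d hPQ hP (hv h 0),
    ENNReal.toReal_ofReal (mul_nonneg (Real.exp_pos _).le hv0),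
    mul_div_cancel_left₀ _ (Real.exp_ne_zero _)]

/-- At d = 0 the exit functional is the indicator of the event, and cancelling det(-Q_n) > 0 shows
that its integral is 1. -/
theorem ae_mem_exitsTo [IsProbabilityMeasure μ] (hQ : IsSkipFree Q)
    (hX : IsMarkovProcess μ X Q 0) (N : ℕ) :
    ∀ᵐ ω ∂μ, ω ∈ exitsTo X (N + 1) := by
  have hle := exitFunctional_le_one (X := X) (d := (0 : Fin (N + 1) → ℝ)) fun _ => le_rfl
  have h1 := det_mul_lintegral_exitFunctional hQ hX (d := (0 : Fin (N + 1) → ℝ)) fun _ => le_rfl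
  rw [Matrix.diagonal_zero', zero_sub, mul_eq_left₀ (det_neg_upperBlock_pos hQ).ne',
    ENNReal.toReal_eq_one_iff] at h1
  have h2 := ae_eq_of_ae_le_of_lintegral_le (μ := μ) (g := fun _ => 1)
    (Eventually.of_forall hle) (by simp [h1]) aemeasurable_const (by simp [h1])
  filter_upwards [h2] with ω hω
  by_contra h
  rw [exitFunctional, if_neg h] at hω
  exact zero_ne_one hω

end limit

end SkipFree

/-! ### The determinant formula -/

theorem mainTheorem1 {Ω : Type*} [MeasurableSpace Ω] (μ : Measure Ω) [IsProbabilityMeasure μ]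
    (X : ℝ≥0 → Ω → ℕ∞) (Q : Matrix ℕ ℕ ℝ) (hQ : SkipFree.IsSkipFree Q)
    (hX : SkipFree.IsMarkovProcess μ X Q 0)
    (n : ℕ) (d : Fin n → ℝ) (hd : ∀ i, 0 ≤ d i) :
    (∀ᵐ ω ∂μ, SkipFree.hittingTime X n ω < ∞) ∧
    (∀ᵐ ω ∂μ, ∀ i : Fin n,
      SkipFree.occupationTime X i (SkipFree.hittingTime X n ω) ω < ∞) ∧
    Integrable (fun ω => Real.exp (-∑ i : Fin n, d i *
      (SkipFree.occupationTime X i (SkipFree.hittingTime X n ω) ω).toReal)) μ ∧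
    (Matrix.diagonal d - SkipFree.upperBlock Q n).det ≠ 0 ∧
    ∫ ω, Real.exp (-∑ i : Fin n, d i *
      (SkipFree.occupationTime X i (SkipFree.hittingTime X n ω) ω).toReal) ∂μ =
      (-SkipFree.upperBlock Q n).det /
        (Matrix.diagonal d - SkipFree.upperBlock Q n).det := by
  rcases n with _ | N
  -- For n = 0 the hitting time is 0, the sum is empty and both determinants are 1.
  · refine ⟨?_, Eventually.of_forall fun _ i => i.elim0, by simp, by simp, by simp⟩
    filter_upwards [hX.start] with ω h0
    rw [SkipFree.hittingTime_zero h0]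
    exact ENNReal.zero_lt_top
  have hS := SkipFree.ae_mem_exitsTo hQ hX N
  have hdet := SkipFree.det_mul_lintegral_exitFunctional hQ hX hd
  have hne : (Matrix.diagonal d - SkipFree.upperBlock Q (N + 1)).det ≠ 0 := by
    intro h
    rw [h, zero_mul] at hdet
    exact (SkipFree.det_neg_upperBlock_pos hQ).ne hdet
  have hmeas := SkipFree.aemeasurable_exitFunctional hX N.succ_pos d
  have hle := SkipFree.exitFunctional_le_one (X := X) hd
  have heq : (fun ω => (SkipFree.exitFunctional X d ω).toReal) =ᵐ[μ]
      fun ω => Real.exp (-∑ i : Fin (N + 1), d i *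
        (SkipFree.occupationTime X i (SkipFree.hittingTime X (N + 1) ω) ω).toReal) := by
    filter_upwards [hS] with ω hω
    rw [SkipFree.exitFunctional, if_pos hω, ENNReal.toReal_ofReal (Real.exp_pos _).le]
  refine ⟨?_, ?_, ?_, hne, ?_⟩
  · filter_upwards [hS] with ω hω using SkipFree.hittingTime_lt_top hω
  · filter_upwards [hS] with ω hω i using SkipFree.occupationTime_lt_top hω i
  · refine (integrable_toReal_of_lintegral_ne_top hmeas ?_).congr heq
    exact ((lintegral_mono hle).trans_lt (by simp)).ne
  · rw [← integral_congr_ae heq, integral_toReal hmeas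
      (Eventually.of_forall fun ω => (hle ω).trans_lt ENNReal.one_lt_top), eq_div_iff hne,
      mul_comm, hdet]
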